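/- Let $\mathcal W$ be a real-valued even tempered distribution on $\mathbb R$ whose Fourier transform $\widehat{\mathcal W}$ (with the convention $\widehat f(\xi)=\int_{\mathbb R}e^{-ix\xi}f(x)\,dx$) belongs to $L^\infty(\mathbb R)$; for $f\in L^2(\mathbb R)$ let $\mathcal W*f\in L^2(\mathbb R)$ denote the function with $\widehat{\mathcal W*f}=\widehat{\mathcal W}\,\widehat f$. Assume that there are $\sigma\in(0,1]$ and $\kappa\in[0,1/2]$ such that $\widehat{\mathcal W}(\xi)\ge\sigma-\kappa\xi^2$ for a.e. $\xi\in\mathbb R$, and that $\widehat{\mathcal W}$ is weakly differentiable with $|(\widehat{\mathcal W})'(\xi)|\le C(|\xi|+1)$ for a.e. $\xi\in\mathbb R$, for some $C>0$. Let $c\in[0,\sqrt{2\sigma})$ and let $u:\mathbb R\to\mathbb C$ be a finite-energy solution of $$icu'+u''+u\,\bigl(\mathcal W*(1-|u|^2)\bigr)=0\quad\text{in }\mathbb R,$$ that is, $u\in H^1_{\rm loc}(\mathbb R)$, $u'\in L^2(\mathbb R)$, $1-|u|^2\in L^2(\mathbb R)$, and the equation holds in the sense of distributions. Then, identifying $u$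 with its continuous representative, there exists $r>0$ such that $\eta=1-|u|^2$ and $u$ have analytic extensions to the strip $\{z\in\mathbb C:|\operatorname{Im}z|<r\}$. Moreover, if $c\in(0,\sqrt{2\sigma})$, then $\operatorname{Re}u$ and $\operatorname{Im}u$ are real analytic on $\mathbb R$. -/

import Mathlib

open MeasureTheory SchwartzMap
open scoped FourierTransform ENNReal ContDiff

noncomputable section

namespace NonlocalGP

/-- The dilation `ξ ↦ ξ / (2π)` of the real line. -/
def dilation : ℝ ≃L[ℝ] ℝ :=
  ContinuousLinearEquiv.unitsEquivAut ℝ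
    (Units.mk0 (2 * Real.pi)⁻¹ (inv_ne_zero (by positivity)))

/-- The Fourier transform `φ̂(ξ) = ∫ e^{-i x ξ} φ(x) dx` of a Schwartz function (Mathlib's `𝓕` has
`e^{-2π i x ξ}` instead; see `angularFourier_apply`). -/
def angularFourier (φ : 𝓢(ℝ, ℂ)) : 𝓢(ℝ, ℂ) :=
  SchwartzMap.compCLMOfContinuousLinearEquiv ℂ dilation (𝓕 φ)

theorem angularFourier_apply (φ : 𝓢(ℝ, ℂ)) (ξ : ℝ) :
    angularFourier φ ξ = ∫ x : ℝ, Complex.exp (-(Complex.I * x * ξ)) * φ x := by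
  have h : angularFourier φ ξ = 𝓕 (φ : ℝ → ℂ) (ξ * (2 * Real.pi)⁻¹) := by
    simp [angularFourier, dilation, SchwartzMap.fourier_coe]
  rw [h, Real.fourier_real_eq_integral_exp_smul]
  congr 1
  ext x
  rw [smul_eq_mul]
  congr 2
  have : (Real.pi : ℂ) ≠ 0 := by exact_mod_cast Real.pi_ne_zero
  push_cast
  field_simp

/-- The reflection `x ↦ φ(-x)` of a Schwartz function. -/
def reflect (φ : 𝓢(ℝ, ℂ)) : 𝓢(ℝ, ℂ) :=
  SchwartzMap.compCLMOfContinuousLinearEquiv ℂ (ContinuousLinearEquiv.neg ℝ) φ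

/-- A real-valued even tempered distribution `𝒲` on `ℝ` whose Fourier transform `𝒲̂` is
(represented by) a function of `L^∞(ℝ)`. The transform of a distribution is defined by duality,
`⟨𝒲̂, φ⟩ = ⟨𝒲, φ̂⟩`. For a real and even `𝒲` the function `𝒲̂` is real-valued. -/
structure Potential where
  /-- the distribution `𝒲` -/
  dist : 𝓢'(ℝ, ℂ)
  real : ∀ φ : 𝓢(ℝ, ℂ), (∀ x, (φ x).im = 0) → (dist φ).im = 0
  even : ∀ φ : 𝓢(ℝ, ℂ), dist (reflect φ) = dist φ
  /-- the function `𝒲̂` -/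
  hat : ℝ → ℝ
  hat_memLp : MemLp hat ∞ volume
  fourier_eq : ∀ φ : 𝓢(ℝ, ℂ), dist (angularFourier φ) = ∫ ξ : ℝ, (hat ξ : ℂ) * φ ξ

namespace Potential

/-- Rewriting `𝒲̂` in the frequency variable of Mathlib's Fourier transform. -/
theorem memLp_symbol (W : Potential) :
    MemLp (fun ξ : ℝ => (W.hat (2 * Real.pi * ξ) : ℂ)) ∞ volume := by
  have hq : Measure.QuasiMeasurePreserving (fun ξ : ℝ => 2 * Real.pi * ξ) volume volume := by
    refine ⟨by fun_prop, ?_⟩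
    rw [Real.map_volume_mul_left (by positivity)]
    exact Measure.smul_absolutelyContinuous
  have hb := hq.ae (ae_le_eLpNormEssSup (f := W.hat) (μ := volume))
  have hfin : eLpNormEssSup W.hat volume ≠ ⊤ := by
    have := W.hat_memLp.2.ne
    rwa [eLpNorm_exponent_top] at this
  refine memLp_top_of_bound
    (Complex.continuous_ofReal.comp_aestronglyMeasurable
      (W.hat_memLp.1.comp_quasiMeasurePreserving hq))
    (eLpNormEssSup W.hat volume).toReal ?_
  filter_upwards [hb] with ξ hξ
  rw [Complex.norm_real, ← toReal_enorm]
  exact ENNReal.toReal_mono hfin hξ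

/-- The convolution `f ↦ 𝒲 * f` on `L²(ℝ)`: the operator with `(𝒲 * f)^ = 𝒲̂ f̂`. With Mathlib's
`𝓕 f (ξ) = f̂(2πξ)` this reads `𝓕 (𝒲 * f) (ξ) = 𝒲̂(2πξ) 𝓕 f (ξ)`. -/
def conv (W : Potential) (f : Lp ℂ 2 (volume : Measure ℝ)) : Lp ℂ 2 (volume : Measure ℝ) :=
  𝓕⁻ ((W.memLp_symbol.toLp _ • 𝓕 f : Lp ℂ 2 (volume : Measure ℝ)))

end Potential

/-- `g` is the weak derivative of `f` on `ℝ`. -/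
structure HasWeakDeriv {E : Type*} [NormedAddCommGroup E] [NormedSpace ℝ E]
    (f g : ℝ → E) : Prop where
  locallyIntegrable : LocallyIntegrable f volume
  locallyIntegrable_deriv : LocallyIntegrable g volume
  integral_eq : ∀ φ : ℝ → ℝ, ContDiff ℝ ∞ φ → HasCompactSupport φ →
    ∫ x, deriv φ x • f x = -∫ x, φ x • g x

/-- `η = 1 - |u|²`. -/
def eta (u : ℝ → ℂ) (x : ℝ) : ℂ := ((1 - ‖u x‖ ^ 2 : ℝ) : ℂ)

/-- The energy space: `u ∈ H¹_loc(ℝ)`, `1 - |u|² ∈ L²(ℝ)` and `u' ∈ L²(ℝ)`. Its elements are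
functions up to almost everywhere equality. -/
structure MemEnergySpace (u : ℝ → ℂ) : Prop where
  memLp_loc : ∀ K : Set ℝ, IsCompact K → MemLp u 2 (volume.restrict K)
  exists_weakDeriv : ∃ v : ℝ → ℂ, HasWeakDeriv u v ∧ MemLp v 2 volume
  memLp_eta : MemLp (eta u) 2 volume

/-- A finite energy solution of `i c u' + u'' + u (𝒲 * (1 - |u|²)) = 0` on `ℝ`: an element of the
energy space that satisfies the equation in the sense of distributions. -/
structure IsFiniteEnergySolution (W : Potential) (c : ℝ) (u : ℝ → ℂ) : Prop where
  mem : MemEnergySpace u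
  equation : ∀ φ : ℝ → ℝ, ContDiff ℝ ∞ φ → HasCompactSupport φ →
    ∫ x, u x * (-(Complex.I * c * ((deriv φ x : ℝ) : ℂ)) + ((deriv (deriv φ) x : ℝ) : ℂ)
      + W.conv (mem.memLp_eta.toLp (eta u)) x * (φ x : ℂ)) = 0

/-- The strip `{z : |Im z| < r}`. -/
def strip (r : ℝ) : Set ℂ := {z | |z.im| < r}

/-- `F` is an analytic extension of `f : ℝ → ℂ` to the strip of half-width `r`. -/
def IsAnalyticExtension (f : ℝ → ℂ) (r : ℝ) (F : ℂ → ℂ) : Prop :=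
  AnalyticOnNhd ℂ F (strip r) ∧ ∀ x : ℝ, F x = f x

end NonlocalGP

end

/-!
# Analyticity of finite energy solutions

The convolution `T = 𝒲 *` is a Fourier multiplier with a bounded symbol, so it is bounded on `L²` and
commutes with `d/dx`. For a solution, `u'' = -i c u' - u T η` and `η' = -2 Re (ū u')`: every
derivative of `u` or `η` is expressed through lower ones by products and by `T`, an operator of
order zero. Since `H¹(ℝ)` is a Banach algebra contained in `L^∞`, this is an ordinary differential
equation with a quadratic right-hand side in `H¹`, and its solutions are analytic.

Regularity: `u` has a bounded continuous representative, because `η` and `u'` are in `L²`. The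
equation then yields, one derivative at a time, that `u'` and `η` belong to all Sobolev spaces
(`squareIntegrableUpTo_deriv_of_solution`). What makes this work is that `T f` has the weak
derivative `T f'` (`hasWeakDeriv_conv`) and that a weak derivative which is continuous is a classical
one (`HasWeakDeriv.hasDerivAt_of_continuous`).

Estimates: with `‖f‖ + ‖f'‖` as norm of `H¹`, the Leibniz rule turns the two identities above into
recursive inequalities between the norms of `u^(k)` and `η^(k)`, and these force growth at most
`K R^k k!` (`exists_factorial_bound`). The bounds are global on `ℝ`, because the norms are.

Extension: under such bounds `∑ f^(k)(x) (i y)^k / k!` converges on a strip, can be differentiated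
term by term and satisfies the Cauchy-Riemann equations (`exists_isAnalyticExtension`).
-/

namespace NonlocalGP
open Set Filter Topology

/-! ### Weak derivatives on the line -/

theorem intervalIntegrable_of_locallyIntegrable {E : Type*} [NormedAddCommGroup E] {g : ℝ → E}
    (hg : LocallyIntegrable g volume) (a b : ℝ) : IntervalIntegrable g volume a b :=
  (hg.integrableOn_isCompact isCompact_uIcc).intervalIntegrable

/-- The du Bois-Reymond lemma: the mollifications of `w` have zero derivative, hence are constant, and
they converge to `w` almost everywhere. -/
theorem exists_ae_eq_const_of_integral_deriv_smul_eq_zero {E : Type*} [NormedAddCommGroup E]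
    [NormedSpace ℝ E] [CompleteSpace E] {w : ℝ → E} (hw : LocallyIntegrable w volume)
    (h : ∀ φ : ℝ → ℝ, ContDiff ℝ ∞ φ → HasCompactSupport φ → ∫ x, deriv φ x • w x = 0) :
    ∃ a : E, ∀ᵐ x, w x = a := by
  let χ : ℕ → ContDiffBump (0 : ℝ) := fun n =>
    ⟨1 / (n + 1) / 2, 1 / (n + 1), by positivity, half_lt_self (by positivity)⟩
  have hconst : ∀ n x y, convolution ((χ n).normed volume) w (ContinuousLinearMap.lsmul ℝ ℝ) volume x
      = convolution ((χ n).normed volume) w (ContinuousLinearMap.lsmul ℝ ℝ) volume y := by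
    intro n
    have hd : ∀ x, HasDerivAt
        (convolution ((χ n).normed volume) w (ContinuousLinearMap.lsmul ℝ ℝ) volume) 0 x := by
      intro x
      have h1 := HasCompactSupport.hasDerivAt_convolution_left (ContinuousLinearMap.lsmul ℝ ℝ)
        (χ n).hasCompactSupport_normed ((χ n).contDiff_normed (n := 1) (μ := volume)) hw x
      convert h1 using 1
      rw [convolution_eq_swap]
      have h2 := h (fun t => (χ n).normed volume (x - t))
        ((χ n).contDiff_normed.comp (contDiff_const.sub contDiff_id))
        ((χ n).hasCompactSupport_normed.comp_homeomorph (Homeomorph.subLeft x))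
      simp only [deriv_comp_const_sub] at h2
      simp only [ContinuousLinearMap.lsmul_apply]
      simp only [neg_smul, integral_neg, neg_eq_zero] at h2
      exact h2.symm
    exact is_const_of_deriv_eq_zero (fun x => (hd x).differentiableAt) (fun x => (hd x).deriv)
  have hlim : Tendsto (fun n => (χ n).rOut) atTop (𝓝 0) := tendsto_one_div_add_atTop_nhds_zero_nat
  have hae := ContDiffBump.ae_convolution_tendsto_right_of_locallyIntegrable (K := 2) hlim
    (Eventually.of_forall fun n => by simp [χ]; linarith) hw
  obtain ⟨x₀, hx₀⟩ := hae.exists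
  refine ⟨w x₀, ?_⟩
  filter_upwards [hae] with x hx
  refine tendsto_nhds_unique hx (hx₀.congr fun n => hconst n x₀ x)

theorem integral_deriv_mul_primitive_real {g : ℝ → ℝ} (hg : LocallyIntegrable g volume)
    {φ : ℝ → ℝ} (hφ : ContDiff ℝ ∞ φ) (hc : HasCompactSupport φ) :
    ∫ x, deriv φ x * ∫ t in (0 : ℝ)..x, g t = -∫ x, φ x * g x := by
  obtain ⟨R, hR0, hR⟩ : ∃ R : ℝ, 0 < R ∧ tsupport φ ⊆ Ioo (-R) R := by
    obtain ⟨R, hR⟩ := (Metric.isBounded_iff_subset_ball 0).1 hc.isCompact.isBounded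
    refine ⟨max R 1, by positivity, hR.trans ?_⟩
    rw [Real.ball_eq_Ioo]
    refine Ioo_subset_Ioo ?_ ?_ <;> simp
  have hint : ∀ a b, IntervalIntegrable g volume a b := fun a b =>
    intervalIntegrable_of_locallyIntegrable hg a b
  have hAC1 : AbsolutelyContinuousOnInterval φ (-R) R :=
    (hφ.of_le (by simp)).contDiffOn.absolutelyContinuousOnInterval
  have hAC2 : AbsolutelyContinuousOnInterval (fun x => ∫ t in (0 : ℝ)..x, g t) (-R) R :=
    (hint _ _).absolutelyContinuousOnInterval_intervalIntegral
      (by rw [uIcc_of_le (by linarith)]; constructor <;> linarith)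
  have hparts := hAC1.integral_mul_deriv_eq_deriv_mul hAC2
  have hz : ∀ x, x ∉ Ioo (-R) R → φ x = 0 := fun x hx =>
    image_eq_zero_of_notMem_tsupport fun h => hx (hR h)
  rw [hz R (by simp), hz (-R) (by simp)] at hparts
  have hae : ∀ᵐ x, deriv (fun x => ∫ t in (0 : ℝ)..x, g t) x = g x := by
    filter_upwards [LocallyIntegrable.ae_hasDerivAt_integral hg] with x hx using (hx 0).deriv
  have h1 : ∫ x in (-R)..R, φ x * deriv (fun x => ∫ t in (0 : ℝ)..x, g t) x = ∫ x, φ x * g x := by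
    rw [intervalIntegral.integral_eq_integral_of_support_subset]
    · exact integral_congr_ae (by filter_upwards [hae] with x hx; rw [hx])
    · intro x hx
      have := (left_ne_zero_of_mul hx)
      exact Ioo_subset_Ioc_self (hR (subset_tsupport _ this))
  have h2 : ∫ x in (-R)..R, deriv φ x * (∫ t in (0 : ℝ)..x, g t)
      = ∫ x, deriv φ x * ∫ t in (0 : ℝ)..x, g t := by
    rw [intervalIntegral.integral_eq_integral_of_support_subset]
    intro x hx
    have := (left_ne_zero_of_mul hx)
    exact Ioo_subset_Ioc_self (hR (support_deriv_subset this))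
  rw [h1, h2] at hparts
  linarith

theorem _root_.MeasureTheory.LocallyIntegrable.integrable_test_smul {g : ℝ → ℂ}
    (hg : LocallyIntegrable g volume) {φ : ℝ → ℝ} (hφ : Continuous φ) (hc : HasCompactSupport φ) :
    Integrable (fun x => φ x • g x) :=
  hg.integrable_smul_left_of_hasCompactSupport hφ hc

theorem integral_deriv_smul_primitive {g : ℝ → ℂ} (hg : LocallyIntegrable g volume)
    {φ : ℝ → ℝ} (hφ : ContDiff ℝ ∞ φ) (hc : HasCompactSupport φ) :
    ∫ x, deriv φ x • ∫ t in (0 : ℝ)..x, g t = -∫ x, φ x • g x := by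
  have hint : ∀ a b, IntervalIntegrable g volume a b := fun a b =>
    intervalIntegrable_of_locallyIntegrable hg a b
  have hcont : Continuous (fun x => ∫ t in (0 : ℝ)..x, g t) :=
    intervalIntegral.continuous_primitive hint 0
  have hi1 := hcont.locallyIntegrable.integrable_test_smul
    (hφ.continuous_deriv (by simp)) hc.deriv
  have hi2 := hg.integrable_test_smul hφ.continuous hc
  have hre : LocallyIntegrable (fun x => (g x).re) volume := fun x =>
    let ⟨s, hs, hi⟩ := hg x
    ⟨s, hs, hi.re⟩
  have him : LocallyIntegrable (fun x => (g x).im) volume := fun x =>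
    let ⟨s, hs, hi⟩ := hg x
    ⟨s, hs, hi.im⟩
  have e1 := integral_deriv_mul_primitive_real hre hφ hc
  have e2 := integral_deriv_mul_primitive_real him hφ hc
  have pr : ∀ x, (∫ t in (0 : ℝ)..x, g t).re = ∫ t in (0 : ℝ)..x, (g t).re := fun x =>
    (Complex.reCLM.intervalIntegral_comp_comm (hint 0 x)).symm
  have pi : ∀ x, (∫ t in (0 : ℝ)..x, g t).im = ∫ t in (0 : ℝ)..x, (g t).im := fun x =>
    (Complex.imCLM.intervalIntegral_comp_comm (hint 0 x)).symm
  apply Complex.ext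
  · have a1 := integral_re hi1
    have a2 := integral_re hi2
    simp only [RCLike.re_to_complex, Complex.real_smul, Complex.re_ofReal_mul] at a1 a2
    simp only [Complex.real_smul, Complex.neg_re]
    rw [← a1, ← a2, ← e1]; simp_rw [pr]
  · have a1 := integral_im hi1
    have a2 := integral_im hi2
    simp only [RCLike.im_to_complex, Complex.real_smul, Complex.im_ofReal_mul] at a1 a2
    simp only [Complex.real_smul, Complex.neg_im]
    rw [← a1, ← a2, ← e2]; simp_rw [pi]

/-- A function with a weak derivative has an absolutely continuous representative. -/
theorem HasWeakDeriv.exists_ae_eq_primitive {f g : ℝ → ℂ} (h : HasWeakDeriv f g) :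
    ∃ F : ℝ → ℂ, f =ᵐ[volume] F ∧ Continuous F ∧
      ∀ x y, F y - F x = ∫ t in x..y, g t := by
  have hint : ∀ a b, IntervalIntegrable g volume a b := fun a b =>
    intervalIntegrable_of_locallyIntegrable h.locallyIntegrable_deriv a b
  have hcont : Continuous (fun x => ∫ t in (0 : ℝ)..x, g t) :=
    intervalIntegral.continuous_primitive hint 0
  obtain ⟨a, ha⟩ := exists_ae_eq_const_of_integral_deriv_smul_eq_zero
    (w := f - fun x => ∫ t in (0 : ℝ)..x, g t)
    (h.locallyIntegrable.sub hcont.locallyIntegrable) (by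
      intro φ hφ hc
      have hd := hφ.continuous_deriv (by simp)
      simp only [Pi.sub_apply, smul_sub]
      rw [integral_sub (h.locallyIntegrable.integrable_test_smul hd hc.deriv)
        (hcont.locallyIntegrable.integrable_test_smul hd hc.deriv), h.integral_eq φ hφ hc,
        integral_deriv_smul_primitive h.locallyIntegrable_deriv hφ hc, sub_self])
  refine ⟨fun x => a + ∫ t in (0 : ℝ)..x, g t, ?_, by fun_prop, ?_⟩
  · filter_upwards [ha] with x hx
    simp [← hx]
  · intro x y
    simp [intervalIntegral.integral_interval_sub_left (hint 0 y) (hint 0 x)]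

theorem HasWeakDeriv.congr {f g f' g' : ℝ → ℂ} (h : HasWeakDeriv f g) (hf : f =ᵐ[volume] f')
    (hg : g =ᵐ[volume] g') : HasWeakDeriv f' g' where
  locallyIntegrable := h.locallyIntegrable.congr hf
  locallyIntegrable_deriv := h.locallyIntegrable_deriv.congr hg
  integral_eq φ hφ hc := by
    have e1 : ∫ x, deriv φ x • f' x = ∫ x, deriv φ x • f x :=
      integral_congr_ae (by filter_upwards [hf] with x hx; rw [hx])
    have e2 : ∫ x, φ x • g' x = ∫ x, φ x • g x :=
      integral_congr_ae (by filter_upwards [hg] with x hx; rw [hx])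
    rw [e1, e2, h.integral_eq φ hφ hc]

theorem HasWeakDeriv.hasDerivAt_of_continuous {f g : ℝ → ℂ} (h : HasWeakDeriv f g)
    (hf : Continuous f) (hg : Continuous g) (x : ℝ) : HasDerivAt f (g x) x := by
  obtain ⟨F, hF, hFc, hFi⟩ := h.exists_ae_eq_primitive
  have hfF : f = F := hf.ae_eq_iff_eq volume hFc |>.1 hF
  have hd := intervalIntegral.integral_hasDerivAt_right (hg.intervalIntegrable 0 x)
    (hg.stronglyMeasurableAtFilter _ _) hg.continuousAt
  rw [hfF]
  refine (hd.const_add (F 0)).congr_of_eventuallyEq (Eventually.of_forall fun y => ?_)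
  simp only [← hFi 0 y]
  ring

/-- The sup norm over a unit interval is controlled by the `L¹` norms of a function and of its
derivative. -/
theorem norm_le_integral_add_integral {f g : ℝ → ℂ} (hf : Continuous f)
    (hg : LocallyIntegrable g volume) (h : ∀ x y, f y - f x = ∫ t in x..y, g t) (x : ℝ) :
    ‖f x‖ ≤ (∫ t in Ioc x (x + 1), ‖f t‖) + ∫ t in Ioc x (x + 1), ‖g t‖ := by
  have hgi : IntegrableOn g (Ioc x (x + 1)) :=
    (hg.integrableOn_isCompact isCompact_Icc).mono_set Ioc_subset_Icc_self
  have hfi : IntegrableOn f (Ioc x (x + 1)) :=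
    (hf.locallyIntegrable.integrableOn_isCompact isCompact_Icc).mono_set Ioc_subset_Icc_self
  have hv : (volume : Measure ℝ).real (Ioc x (x + 1)) = 1 := by simp [Measure.real]
  have key : ∀ y ∈ Ioc x (x + 1), ‖f x‖ - (∫ t in Ioc x (x + 1), ‖g t‖) ≤ ‖f y‖ := by
    intro y hy
    have h1 : ‖f y - f x‖ ≤ ∫ t in Ioc x (x + 1), ‖g t‖ := by
      rw [h x y, intervalIntegral.integral_of_le hy.1.le]
      exact (norm_integral_le_integral_norm _).trans
        (setIntegral_mono_set hgi.norm (Eventually.of_forall fun _ => norm_nonneg _)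
          (Ioc_subset_Ioc_right hy.2).eventuallyLE)
    have h2 : ‖f x‖ - ‖f y‖ ≤ ‖f y - f x‖ := by
      rw [norm_sub_rev]; exact norm_sub_norm_le _ _
    linarith
  have := setIntegral_mono_on (integrableOn_const (by simp)) hfi.norm measurableSet_Ioc key
  rw [setIntegral_const, hv, one_smul] at this
  linarith

/-! ### Convolution with the potential and differentiation -/

theorem fourier_derivCLM_apply (ψ : 𝓢(ℝ, ℂ)) (ξ : ℝ) :
    𝓕 (derivCLM ℂ ℂ ψ) ξ = 2 * Real.pi * Complex.I * ξ * 𝓕 ψ ξ := by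
  have h := Real.fourier_deriv ψ.integrable ψ.differentiable (derivCLM ℂ ℂ ψ).integrable
  have := congrFun h ξ
  rw [smul_eq_mul] at this
  rw [SchwartzMap.fourier_coe, SchwartzMap.fourier_coe]
  exact this

theorem inner_schwartz_toLp (ψ : 𝓢(ℝ, ℂ)) (F : Lp ℂ 2 (volume : Measure ℝ)) :
    inner ℂ (ψ.toLp 2) F = ∫ x, star (ψ x) * F x := by
  rw [L2.inner_def]
  refine integral_congr_ae ?_
  filter_upwards [ψ.coeFn_toLp 2 volume] with x hx
  rw [hx, RCLike.inner_apply, mul_comm]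
  rfl

theorem integral_star_deriv_mul {f g : ℝ → ℂ} (h : ∀ x, HasDerivAt f (g x) x)
    (hf : MemLp f 2 volume) (hg : MemLp g 2 volume) (ψ : 𝓢(ℝ, ℂ)) :
    ∫ x, star (derivCLM ℂ ℂ ψ x) * f x = -∫ x, star (ψ x) * g x := by
  have hψ : ∀ χ : 𝓢(ℝ, ℂ), MemLp (fun x => star (χ x)) 2 volume := fun χ => (χ.memLp 2).star
  have := integral_mul_deriv_eq_deriv_mul_of_integrable (u := fun x => star (ψ x)) (v := f)
    (u' := fun x => star (derivCLM ℂ ℂ ψ x)) (v' := g)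
    (fun x _ => (ψ.hasDerivAt x).star) (fun x _ => h x)
    ((hψ ψ).integrable_mul hg) ((hψ _).integrable_mul hf) ((hψ ψ).integrable_mul hf)
  rw [this, neg_neg]

theorem exists_schwartz_eq_ofReal {φ : ℝ → ℝ} (hφ : ContDiff ℝ ∞ φ) (hc : HasCompactSupport φ) :
    ∃ χ : 𝓢(ℝ, ℂ), (∀ x, χ x = φ x) ∧ ∀ x, derivCLM ℂ ℂ χ x = (deriv φ x : ℝ) := by
  have h1 : HasCompactSupport (fun x => (φ x : ℂ)) := hc.comp_left Complex.ofReal_zero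
  have h2 : ContDiff ℝ ∞ (fun x => (φ x : ℂ)) := Complex.ofRealCLM.contDiff.comp hφ
  refine ⟨h1.toSchwartzMap h2, fun x => rfl, fun x => ?_⟩
  exact ((hφ.differentiable (by simp) x).hasDerivAt.ofReal_comp).deriv

theorem inner_fourier_derivCLM (ψ : 𝓢(ℝ, ℂ)) (F : Lp ℂ 2 (volume : Measure ℝ)) :
    inner ℂ (𝓕 ((derivCLM ℂ ℂ ψ).toLp 2)) F
      = -∫ ξ : ℝ, star (𝓕 ψ ξ) * (2 * Real.pi * Complex.I * ξ * F ξ) := by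
  rw [SchwartzMap.toLp_fourier_eq, inner_schwartz_toLp, ← integral_neg]
  congr 1
  ext ξ
  rw [fourier_derivCLM_apply]
  simp
  ring

/-- On `L²` the Fourier transform of a classical derivative is `2πiξ` times that of the function; this
is Plancherel's theorem tested against Schwartz functions. -/
theorem fourier_toLp_deriv {f g : ℝ → ℂ} (h : ∀ x, HasDerivAt f (g x) x)
    (hf : MemLp f 2 volume) (hg : MemLp g 2 volume) :
    ∀ᵐ ξ : ℝ, (𝓕 (hg.toLp g) : Lp ℂ 2 (volume : Measure ℝ)) ξ
      = 2 * Real.pi * Complex.I * ξ * (𝓕 (hf.toLp f) : Lp ℂ 2 (volume : Measure ℝ)) ξ := by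
  have hl : ∀ F : Lp ℂ 2 (volume : Measure ℝ), LocallyIntegrable F volume := fun F =>
    (Lp.memLp F).locallyIntegrable (by norm_num)
  have hl' : LocallyIntegrable (fun ξ : ℝ => 2 * Real.pi * Complex.I * ξ *
      (𝓕 (hf.toLp f) : Lp ℂ 2 (volume : Measure ℝ)) ξ) volume := by
    rw [← locallyIntegrableOn_univ]
    exact ((locallyIntegrableOn_univ.2 (hl _)).continuousOn_mul (by fun_prop)
      isOpen_univ.isLocallyClosed)
  refine ae_eq_of_integral_contDiff_smul_eq (hl _) hl' fun φ hφ hc => ?_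
  obtain ⟨χ, hχ, -⟩ := exists_schwartz_eq_ofReal hφ hc
  have hstar : ∀ ξ, star (χ ξ) = (φ ξ : ℂ) := fun ξ => by rw [hχ]; exact Complex.conj_ofReal _
  have key : inner ℂ ((derivCLM ℂ ℂ (𝓕⁻ χ)).toLp 2) (hf.toLp f)
      = -inner ℂ ((𝓕⁻ χ).toLp 2) (hg.toLp g) := by
    rw [inner_schwartz_toLp, inner_schwartz_toLp]
    have e1 : ∫ x, star (derivCLM ℂ ℂ (𝓕⁻ χ) x) * hf.toLp f x
        = ∫ x, star (derivCLM ℂ ℂ (𝓕⁻ χ) x) * f x :=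
      integral_congr_ae (by filter_upwards [hf.coeFn_toLp] with x hx; rw [hx])
    have e2 : ∫ x, star ((𝓕⁻ χ) x) * hg.toLp g x = ∫ x, star ((𝓕⁻ χ) x) * g x :=
      integral_congr_ae (by filter_upwards [hg.coeFn_toLp] with x hx; rw [hx])
    rw [e1, e2, integral_star_deriv_mul h hf hg]
  rw [← Lp.inner_fourier_eq, inner_fourier_derivCLM, ← Lp.inner_fourier_eq,
    SchwartzMap.toLp_fourier_eq, inner_schwartz_toLp, FourierTransform.fourier_fourierInv_eq,
    neg_inj] at key
  simp only [hstar] at key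
  simpa only [Complex.real_smul] using key.symm

theorem fourier_conv (W : Potential) (f : Lp ℂ 2 (volume : Measure ℝ)) :
    ∀ᵐ ξ : ℝ, (𝓕 (W.conv f) : Lp ℂ 2 (volume : Measure ℝ)) ξ
      = W.hat (2 * Real.pi * ξ) * (𝓕 f : Lp ℂ 2 (volume : Measure ℝ)) ξ := by
  unfold Potential.conv
  rw [FourierTransform.fourier_fourierInv_eq]
  filter_upwards [Lp.coeFn_lpSMul (r := 2) (W.memLp_symbol.toLp _) (𝓕 f), W.memLp_symbol.coeFn_toLp]
    with ξ h1 h2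
  rw [h1, Pi.smul_apply', h2, smul_eq_mul]

/-- The convolution with `𝒲` commutes with differentiation: both are Fourier multipliers. -/
theorem hasWeakDeriv_conv (W : Potential) {f g : ℝ → ℂ} (h : ∀ x, HasDerivAt f (g x) x)
    (hf : MemLp f 2 volume) (hg : MemLp g 2 volume) :
    HasWeakDeriv (W.conv (hf.toLp f)) (W.conv (hg.toLp g)) where
  locallyIntegrable := (Lp.memLp _).locallyIntegrable (by norm_num)
  locallyIntegrable_deriv := (Lp.memLp _).locallyIntegrable (by norm_num)
  integral_eq φ hφ hc := by
    obtain ⟨χ, hχ, hχ'⟩ := exists_schwartz_eq_ofReal hφ hc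
    have e1 : ∫ x, deriv φ x • W.conv (hf.toLp f) x
        = inner ℂ ((derivCLM ℂ ℂ χ).toLp 2) (W.conv (hf.toLp f)) := by
      rw [inner_schwartz_toLp]
      simp [hχ', -derivCLM_apply]
    have e2 : ∫ x, φ x • W.conv (hg.toLp g) x
        = inner ℂ (χ.toLp 2) (W.conv (hg.toLp g)) := by
      rw [inner_schwartz_toLp]
      simp [hχ]
    rw [e1, e2, ← Lp.inner_fourier_eq, inner_fourier_derivCLM, ← Lp.inner_fourier_eq,
      SchwartzMap.toLp_fourier_eq, inner_schwartz_toLp]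
    congr 1
    refine integral_congr_ae ?_
    filter_upwards [fourier_conv W (hf.toLp f), fourier_conv W (hg.toLp g),
      fourier_toLp_deriv h hf hg] with ξ h1 h2 h3
    rw [h1, h2, h3]
    ring

theorem conv_norm_le (W : Potential) (f : Lp ℂ 2 (volume : Measure ℝ)) :
    ‖W.conv f‖ ≤ ‖W.memLp_symbol.toLp _‖ * ‖f‖ := by
  unfold Potential.conv
  rw [← Lp.norm_fourier_eq (𝓕⁻ _), FourierTransform.fourier_fourierInv_eq,
    ← Lp.norm_fourier_eq f]
  exact Lp.norm_smul_le _ _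

/-! ### Square integrable and bounded derivatives -/

/-- `f` is a `C^n` function all of whose derivatives up to order `n` are square integrable. -/
def SquareIntegrableUpTo : ℕ → (ℝ → ℂ) → Prop
  | 0, f => Continuous f ∧ MemLp f 2 volume
  | n + 1, f => Differentiable ℝ f ∧ MemLp f 2 volume ∧ SquareIntegrableUpTo n (deriv f)

/-- `f` is a `C^n` function all of whose derivatives up to order `n` are bounded. -/
def BoundedUpTo : ℕ → (ℝ → ℂ) → Prop
  | 0, f => Continuous f ∧ ∃ C, ∀ x, ‖f x‖ ≤ C
  | n + 1, f => Differentiable ℝ f ∧ (∃ C, ∀ x, ‖f x‖ ≤ C) ∧ BoundedUpTo n (deriv f)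

/-- The `L²` norm of a function on the line, as a real number. -/
noncomputable def l2Norm (f : ℝ → ℂ) : ℝ := (eLpNorm f 2 volume).toReal

theorem l2Norm_nonneg (f : ℝ → ℂ) : 0 ≤ l2Norm f := ENNReal.toReal_nonneg

theorem setIntegral_norm_le_l2Norm {f : ℝ → ℂ} (hf : MemLp f 2 volume) (x : ℝ) :
    ∫ t in Ioc x (x + 1), ‖f t‖ ≤ l2Norm f := by
  have : IsProbabilityMeasure (volume.restrict (Ioc x (x + 1))) := ⟨by simp⟩
  rw [integral_norm_eq_lintegral_enorm hf.1.restrict]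
  refine ENNReal.toReal_mono hf.2.ne ?_
  rw [← eLpNorm_one_eq_lintegral_enorm]
  exact (eLpNorm_le_eLpNorm_of_exponent_le (by norm_num) hf.1.restrict).trans
    (eLpNorm_mono_measure _ Measure.restrict_le_self)

theorem norm_le_l2Norm_add_of_eq_primitive {f g : ℝ → ℂ} (hf : Continuous f)
    (hfL : MemLp f 2 volume) (hg : MemLp g 2 volume)
    (h : ∀ x y, f y - f x = ∫ t in x..y, g t) (x : ℝ) :
    ‖f x‖ ≤ l2Norm f + l2Norm g :=
  (norm_le_integral_add_integral hf (hg.locallyIntegrable (by norm_num)) h x).trans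
    (add_le_add (setIntegral_norm_le_l2Norm hfL x) (setIntegral_norm_le_l2Norm hg x))

namespace SquareIntegrableUpTo

theorem memLp {n : ℕ} {f : ℝ → ℂ} (h : SquareIntegrableUpTo n f) : MemLp f 2 volume := by
  cases n with
  | zero => exact h.2
  | succ n => exact h.2.1

theorem continuous {n : ℕ} {f : ℝ → ℂ} (h : SquareIntegrableUpTo n f) : Continuous f := by
  cases n with
  | zero => exact h.1
  | succ n => exact h.1.continuous

theorem of_succ {n : ℕ} {f : ℝ → ℂ} (h : SquareIntegrableUpTo (n + 1) f) :
    SquareIntegrableUpTo n f := by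
  induction n generalizing f with
  | zero => exact ⟨h.1.continuous, h.2.1⟩
  | succ n ih => exact ⟨h.1, h.2.1, ih h.2.2⟩

theorem of_hasDerivAt {n : ℕ} {f g : ℝ → ℂ} (h : ∀ x, HasDerivAt f (g x) x)
    (hf : MemLp f 2 volume) (hg : SquareIntegrableUpTo n g) : SquareIntegrableUpTo (n + 1) f := by
  have : deriv f = g := funext fun x => (h x).deriv
  exact ⟨fun x => (h x).differentiableAt, hf, this ▸ hg⟩

/-- The embedding `H¹(ℝ) ⊆ L^∞(ℝ)`. -/
theorem norm_le {f : ℝ → ℂ} (h : SquareIntegrableUpTo 1 f) (x : ℝ) :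
    ‖f x‖ ≤ l2Norm f + l2Norm (deriv f) :=
  norm_le_l2Norm_add_of_eq_primitive h.1.continuous h.2.1 h.2.2.2
    (fun a b => (intervalIntegral.integral_deriv_eq_sub (fun t _ => h.1 t)
      (h.2.2.1.intervalIntegrable a b)).symm) x

theorem boundedUpTo {n : ℕ} {f : ℝ → ℂ} (h : SquareIntegrableUpTo (n + 1) f) :
    BoundedUpTo n f := by
  induction n generalizing f with
  | zero => exact ⟨h.1.continuous, _, h.norm_le⟩
  | succ n ih =>
    refine ⟨h.1, ⟨_, SquareIntegrableUpTo.norm_le (f := f) ?_⟩, ih h.2.2⟩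
    exact ⟨h.1, h.2.1, h.2.2.continuous, h.2.2.memLp⟩

theorem add {n : ℕ} {f g : ℝ → ℂ} (hf : SquareIntegrableUpTo n f) (hg : SquareIntegrableUpTo n g) :
    SquareIntegrableUpTo n (fun x => f x + g x) := by
  induction n generalizing f g with
  | zero => exact ⟨hf.1.add hg.1, hf.2.add hg.2⟩
  | succ n ih =>
    exact of_hasDerivAt (fun x => (hf.1 x).hasDerivAt.add (hg.1 x).hasDerivAt)
      (hf.2.1.add hg.2.1) (ih hf.2.2 hg.2.2)

theorem const_mul {n : ℕ} {f : ℝ → ℂ} (a : ℂ) (hf : SquareIntegrableUpTo n f) :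
    SquareIntegrableUpTo n (fun x => a * f x) := by
  induction n generalizing f with
  | zero => exact ⟨continuous_const.mul hf.1, hf.2.const_mul a⟩
  | succ n ih =>
    exact of_hasDerivAt (fun x => (hf.1 x).hasDerivAt.const_mul a)
      (hf.2.1.const_mul a) (ih hf.2.2)

theorem star {n : ℕ} {f : ℝ → ℂ} (hf : SquareIntegrableUpTo n f) :
    SquareIntegrableUpTo n (fun x => star (f x)) := by
  induction n generalizing f with
  | zero => exact ⟨hf.1.star, hf.2.star⟩
  | succ n ih =>
    exact of_hasDerivAt (fun x => (hf.1 x).hasDerivAt.star) hf.2.1.star (ih hf.2.2)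

end SquareIntegrableUpTo

namespace BoundedUpTo

theorem continuous {n : ℕ} {f : ℝ → ℂ} (h : BoundedUpTo n f) : Continuous f := by
  cases n with
  | zero => exact h.1
  | succ n => exact h.1.continuous

theorem bounded {n : ℕ} {f : ℝ → ℂ} (h : BoundedUpTo n f) : ∃ C, ∀ x, ‖f x‖ ≤ C := by
  cases n with
  | zero => exact h.2
  | succ n => exact h.2.1

theorem of_succ {n : ℕ} {f : ℝ → ℂ} (h : BoundedUpTo (n + 1) f) : BoundedUpTo n f := by
  induction n generalizing f with
  | zero => exact ⟨h.1.continuous, h.2.1⟩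
  | succ n ih => exact ⟨h.1, h.2.1, ih h.2.2⟩

theorem star {n : ℕ} {f : ℝ → ℂ} (hf : BoundedUpTo n f) : BoundedUpTo n (fun x => star (f x)) := by
  induction n generalizing f with
  | zero => exact ⟨hf.1.star, by simpa using hf.2⟩
  | succ n ih =>
    have hd : _root_.deriv (fun x => Star.star (f x)) = fun x => Star.star (_root_.deriv f x) :=
      funext fun x => (hf.1 x).hasDerivAt.star.deriv
    exact ⟨fun x => (hf.1 x).hasDerivAt.star.differentiableAt, by simpa using hf.2.1,
      hd ▸ ih hf.2.2⟩

end BoundedUpTo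

theorem memLp_bounded_mul {f g : ℝ → ℂ} (hf : Continuous f) (hb : ∃ C, ∀ x, ‖f x‖ ≤ C)
    (hg : MemLp g 2 volume) : MemLp (fun x => f x * g x) 2 volume := by
  obtain ⟨C, hC⟩ := hb
  exact hg.mul (p := ∞) (memLp_top_of_bound hf.aestronglyMeasurable C (Eventually.of_forall hC))

theorem SquareIntegrableUpTo.bounded_mul {n : ℕ} {f g : ℝ → ℂ} (hf : BoundedUpTo n f)
    (hg : SquareIntegrableUpTo n g) : SquareIntegrableUpTo n (fun x => f x * g x) := by
  induction n generalizing f g with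
  | zero => exact ⟨hf.1.mul hg.1, memLp_bounded_mul hf.1 hf.2 hg.2⟩
  | succ n ih =>
    exact of_hasDerivAt (fun x => (hf.1 x).hasDerivAt.mul (hg.1 x).hasDerivAt)
      (memLp_bounded_mul hf.continuous hf.bounded hg.memLp)
      ((ih hf.2.2 hg.of_succ).add (ih hf.of_succ hg.2.2))

/-- The convolution keeps Sobolev regularity. One order is lost here only because a function in `L²`
with weak derivative in `L²` has a representative that is continuous but perhaps not `C^1`. -/
theorem SquareIntegrableUpTo.exists_conv_ae_eq (W : Potential) {n : ℕ} {f : ℝ → ℂ}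
    (hf : SquareIntegrableUpTo (n + 1) f) (hL : MemLp f 2 volume) :
    ∃ θ : ℝ → ℂ, SquareIntegrableUpTo n θ ∧ W.conv (hL.toLp f) =ᵐ[volume] θ := by
  induction n generalizing f with
  | zero =>
    obtain ⟨θ, hθ, hc, -⟩ := (hasWeakDeriv_conv W (fun x => (hf.1 x).hasDerivAt) hL
      hf.2.2.memLp).exists_ae_eq_primitive
    exact ⟨θ, ⟨hc, (memLp_congr_ae hθ).1 (Lp.memLp _)⟩, hθ⟩
  | succ n ih =>
    obtain ⟨χ, hχ, hχe⟩ := ih hf.2.2 hf.2.2.memLp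
    have hw := hasWeakDeriv_conv W (fun x => (hf.1 x).hasDerivAt) hL hf.2.2.memLp
    obtain ⟨θ, hθ, hc, -⟩ := hw.exists_ae_eq_primitive
    exact ⟨θ, of_hasDerivAt ((hw.congr hθ hχe).hasDerivAt_of_continuous hc hχ.continuous)
      ((memLp_congr_ae hθ).1 (Lp.memLp _)) hχ, hθ⟩

theorem eta_eq (u : ℝ → ℂ) (x : ℝ) : eta u x = 1 - u x * star (u x) := by
  simp [eta, Complex.mul_conj, Complex.normSq_eq_norm_sq]

theorem hasDerivAt_eta {u v : ℝ → ℂ} {x : ℝ} (hu : HasDerivAt u (v x) x) :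
    HasDerivAt (eta u) (-(star (u x) * v x + u x * star (v x))) x := by
  have := (hu.mul hu.star).const_sub 1
  rw [show eta u = fun x => 1 - u x * star (u x) from funext (eta_eq u)]
  refine this.congr_deriv ?_
  rw [mul_comm (star (u x))]

/-- Elliptic regularity: the derivative of a bounded solution lies in every Sobolev space. -/
theorem squareIntegrableUpTo_deriv_of_solution (W : Potential) {c : ℝ} {u v : ℝ → ℂ}
    (hu : ∀ x, HasDerivAt u (v x) x) (hub : ∃ C, ∀ x, ‖u x‖ ≤ C) (hv : Continuous v)
    (hvL : MemLp v 2 volume) (hη : MemLp (eta u) 2 volume)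
    (hw : HasWeakDeriv v
      (fun x => -(Complex.I * c) * v x + -1 * (u x * W.conv (hη.toLp (eta u)) x))) (n : ℕ) :
    SquareIntegrableUpTo n v ∧ BoundedUpTo n u ∧ SquareIntegrableUpTo (n + 1) (eta u) := by
  have hdu : deriv u = v := funext fun x => (hu x).deriv
  have hud : Differentiable ℝ u := fun x => (hu x).differentiableAt
  have hbd : ∀ n, SquareIntegrableUpTo n v → BoundedUpTo n u := by
    intro n hn
    cases n with
    | zero => exact ⟨hud.continuous, hub⟩
    | succ n => exact ⟨hud, hub, hdu ▸ hn.boundedUpTo⟩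
  have hηn : ∀ n, SquareIntegrableUpTo n v → SquareIntegrableUpTo (n + 1) (eta u) := by
    intro n hn
    have hb := hbd n hn
    refine SquareIntegrableUpTo.of_hasDerivAt (fun x => hasDerivAt_eta (hu x)) hη ?_
    have := ((SquareIntegrableUpTo.bounded_mul hb.star hn).add
      (SquareIntegrableUpTo.bounded_mul hb hn.star)).const_mul (-1)
    simpa only [neg_one_mul] using this
  suffices h : SquareIntegrableUpTo n v from ⟨h, hbd n h, hηn n h⟩
  induction n with
  | zero => exact ⟨hv, hvL⟩
  | succ n ih =>
    obtain ⟨θ, hθ, hθe⟩ := (hηn n ih).exists_conv_ae_eq W hη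
    have hr : SquareIntegrableUpTo n (fun x => -(Complex.I * c) * v x + -1 * (u x * θ x)) :=
      (ih.const_mul _).add ((SquareIntegrableUpTo.bounded_mul (hbd n ih) hθ).const_mul _)
    refine SquareIntegrableUpTo.of_hasDerivAt (fun x => ?_) hvL hr
    refine HasWeakDeriv.hasDerivAt_of_continuous (hw.congr (ae_eq_refl _) ?_) hv hr.continuous x
    filter_upwards [hθe] with x hx
    rw [hx]

/-! ### The bounded representative of a solution -/

/-- A function of the energy space is bounded: `‖U‖ ≤ 1 + ‖η‖`, so the integrals of `‖U‖` and of `‖v‖`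
over unit intervals are bounded uniformly. -/
theorem exists_bound_of_eq_primitive {U v : ℝ → ℂ} (hU : Continuous U) (hv : MemLp v 2 volume)
    (h : ∀ x y, U y - U x = ∫ t in x..y, v t) (hη : MemLp (eta U) 2 volume) :
    ∃ C, ∀ x, ‖U x‖ ≤ C := by
  refine ⟨1 + l2Norm (eta U) + l2Norm v, fun x => ?_⟩
  refine (norm_le_integral_add_integral hU (hv.locallyIntegrable (by norm_num)) h x).trans
    (add_le_add ?_ (setIntegral_norm_le_l2Norm hv x))
  have hUi : IntegrableOn U (Ioc x (x + 1)) :=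
    (hU.locallyIntegrable.integrableOn_isCompact isCompact_Icc).mono_set Ioc_subset_Icc_self
  have hηi : IntegrableOn (eta U) (Ioc x (x + 1)) :=
    ((hη.locallyIntegrable (by norm_num)).integrableOn_isCompact isCompact_Icc).mono_set
      Ioc_subset_Icc_self
  have h1 : IntegrableOn (fun _ => (1 : ℝ)) (Ioc x (x + 1)) := integrableOn_const (by simp)
  have hpt : ∀ t, ‖U t‖ ≤ 1 + ‖eta U t‖ := by
    intro t
    have : ‖eta U t‖ = |1 - ‖U t‖ ^ 2| := by rw [eta, Complex.norm_real, Real.norm_eq_abs]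
    rw [this]
    have := neg_abs_le (1 - ‖U t‖ ^ 2)
    nlinarith [abs_nonneg (1 - ‖U t‖ ^ 2), norm_nonneg (U t)]
  have hsum : IntegrableOn (fun t => 1 + ‖eta U t‖) (Ioc x (x + 1)) := h1.add hηi.norm
  refine (integral_mono hUi.norm hsum hpt).trans ?_
  rw [integral_add h1 hηi.norm, setIntegral_const]
  simp only [Measure.real, Real.volume_Ioc, add_sub_cancel_left, ENNReal.ofReal_one,
    ENNReal.toReal_one, smul_eq_mul, mul_one]
  exact add_le_add_right (setIntegral_norm_le_l2Norm hη x) 1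

/-- A finite energy solution has a bounded `C^1` representative whose derivative is square
integrable and has a square integrable weak derivative, given by the equation. -/
theorem IsFiniteEnergySolution.exists_representative {W : Potential} {c : ℝ} {u : ℝ → ℂ}
    (hu : IsFiniteEnergySolution W c u) :
    ∃ (U V : ℝ → ℂ) (hη : MemLp (eta U) 2 volume), u =ᵐ[volume] U ∧
      (∀ x, HasDerivAt U (V x) x) ∧ (∃ C, ∀ x, ‖U x‖ ≤ C) ∧ Continuous V ∧ MemLp V 2 volume ∧
      HasWeakDeriv V
        (fun x => -(Complex.I * c) * V x + -1 * (U x * W.conv (hη.toLp (eta U)) x)) := by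
  obtain ⟨v, hv, hvL⟩ := hu.mem.exists_weakDeriv
  obtain ⟨U, hU, hUc, hUi⟩ := hv.exists_ae_eq_primitive
  have hηe : eta u =ᵐ[volume] eta U := by
    filter_upwards [hU] with x hx
    simp [eta, hx]
  have hη : MemLp (eta U) 2 volume := (memLp_congr_ae hηe).1 hu.mem.memLp_eta
  have hLp : hu.mem.memLp_eta.toLp (eta u) = hη.toLp (eta U) := MemLp.toLp_congr _ _ hηe
  have hb := exists_bound_of_eq_primitive hUc hvL hUi hη
  have hUv : HasWeakDeriv U v := hv.congr hU (ae_eq_refl _)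
  set T := W.conv (hη.toLp (eta U)) with hT
  have hUT : MemLp (fun x => U x * T x) 2 volume := memLp_bounded_mul hUc hb (Lp.memLp T)
  have hUTl : LocallyIntegrable (fun x => U x * T x) volume :=
    hUT.locallyIntegrable (by norm_num)
  have hvl := hv.locallyIntegrable_deriv
  have hw : HasWeakDeriv v (fun x => -(Complex.I * c) * v x + -1 * (U x * T x)) := by
    refine ⟨hvl, ((hvL.const_mul _).add (hUT.const_mul _)).locallyIntegrable (by norm_num),
      fun φ hφ hc => ?_⟩
    have hφ' : ContDiff ℝ ∞ (deriv φ) := (contDiff_infty_iff_deriv.1 hφ).2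
    have i1 := hUc.locallyIntegrable (μ := volume).integrable_test_smul hφ'.continuous hc.deriv
    have i2 := hUc.locallyIntegrable (μ := volume).integrable_test_smul
      (hφ'.continuous_deriv (by simp)) hc.deriv.deriv
    have i3 := hUTl.integrable_test_smul hφ.continuous hc
    have i4 := hvl.integrable_test_smul hφ.continuous hc
    have heq := hu.equation φ hφ hc
    rw [hLp, ← hT] at heq
    have e1 : ∫ x, u x * (-(Complex.I * c * ((deriv φ x : ℝ) : ℂ)) + ((deriv (deriv φ) x : ℝ) : ℂ)
        + T x * (φ x : ℂ)) = ∫ x, (-(Complex.I * c) * (deriv φ x • U x) + deriv (deriv φ) x • U x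
          + φ x • (U x * T x)) := by
      refine integral_congr_ae ?_
      filter_upwards [hU] with x hx
      rw [hx]
      simp only [Complex.real_smul]
      ring
    have i12 : Integrable
        (fun x => -(Complex.I * c) * (deriv φ x • U x) + deriv (deriv φ) x • U x) :=
      (i1.const_mul _).add i2
    rw [e1, integral_add i12 i3, integral_add (i1.const_mul _) i2,
      integral_const_mul, hUv.integral_eq φ hφ hc, hUv.integral_eq _ hφ' hc.deriv] at heq
    have e2 : ∫ x, φ x • (-(Complex.I * c) * v x + -1 * (U x * T x))
        = ∫ x, (-(Complex.I * c) * (φ x • v x) + -1 * (φ x • (U x * T x))) := by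
      congr 1
      ext x
      simp only [Complex.real_smul]
      ring
    rw [e2, integral_add (i4.const_mul _) (i3.const_mul _), integral_const_mul, integral_const_mul]
    linear_combination -heq
  obtain ⟨V, hV, hVc, -⟩ := hw.exists_ae_eq_primitive
  refine ⟨U, V, hη, hU, ?_, hb, hVc, (memLp_congr_ae hV).1 hvL, hw.congr hV ?_⟩
  · exact (hUv.congr (ae_eq_refl _) hV).hasDerivAt_of_continuous hUc hVc
  · filter_upwards [hV] with x hx
    rw [hx]

/-! ### Recursive inequalities with factorial growth -/

theorem sum_range_sub_add_one (k : ℕ) :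
    ∑ j ∈ Finset.range (k + 1), (((k - j : ℕ) : ℝ) + 1) = (k + 1) * (k + 2) / 2 := by
  rw [Finset.sum_flip (fun i : ℕ => (i : ℝ) + 1)]
  induction k with
  | zero => simp
  | succ k ih => rw [Finset.sum_range_succ, ih]; push_cast; ring

/-- The Leibniz sum of two sequences of factorial growth. The additional factor `j + 1` in the bound on
`y` produces the `(k + 1) (k + 2)` that two further derivatives gain in the factorial. -/
theorem sum_choose_le {k : ℕ} {x y : ℕ → ℝ} {K L R : ℝ} (hK : 0 ≤ K) (hR : 0 ≤ R)
    (hy0 : ∀ j, 0 ≤ y j) (hx : ∀ j ≤ k, x j ≤ K * R ^ j * j.factorial)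
    (hy : ∀ j ≤ k, y j ≤ L * (j + 1) * R ^ j * j.factorial) :
    ∑ j ∈ Finset.range (k + 1), (k.choose j : ℝ) * (x j * y (k - j))
      ≤ K * L * R ^ k * k.factorial * ((k + 1) * (k + 2) / 2) := by
  rw [← sum_range_sub_add_one, Finset.mul_sum]
  refine Finset.sum_le_sum fun j hj => ?_
  have hjk : j ≤ k := Nat.lt_succ_iff.1 (Finset.mem_range.1 hj)
  have h1 : x j * y (k - j) ≤ (K * R ^ j * j.factorial) *
      (L * (((k - j : ℕ) : ℝ) + 1) * R ^ (k - j) * (k - j).factorial) :=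
    mul_le_mul (hx j hjk) (hy _ (Nat.sub_le _ _)) (hy0 _) (by positivity)
  refine (mul_le_mul_of_nonneg_left h1 (by positivity)).trans_eq ?_
  have h2 : (k.choose j : ℝ) * j.factorial * (k - j).factorial = k.factorial := by
    exact_mod_cast Nat.choose_mul_factorial_mul_factorial hjk
  have h3 : R ^ j * R ^ (k - j) = R ^ k := by rw [← pow_add, Nat.add_sub_cancel' hjk]
  rw [← h2, ← h3]
  ring

/-- The recursive inequalities satisfied by the norms of the derivatives of `u` and of `η` force
both sequences to grow at most like `R ^ k * k!`. -/
theorem exists_factorial_bound {a e : ℕ → ℝ} {c M : ℝ} (hc : 0 ≤ c) (hM : 0 ≤ M)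
    (ha0 : ∀ k, 0 ≤ a k) (he0 : ∀ k, 0 ≤ e k)
    (ha : ∀ k, a (k + 2) ≤ c * a (k + 1)
      + M * ∑ j ∈ Finset.range (k + 1), (k.choose j : ℝ) * (a j * e (k - j)))
    (he : ∀ k, e (k + 1)
      ≤ M * ∑ j ∈ Finset.range (k + 1), (k.choose j : ℝ) * (a j * a (k - j + 1))) :
    ∃ K R : ℝ, 0 < R ∧ ∀ k, a k ≤ K * R ^ k * k.factorial ∧ e k ≤ K * R ^ k * k.factorial := by
  -- The weaker bound on `e` in the induction has a factor `k + 1`, removed at the end by doubling `R`.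
  set K := a 0 + a 1 with hKdef
  have hK : 0 ≤ K := add_nonneg (ha0 0) (ha0 1)
  set L := e 0 + M * K ^ 2 with hLdef
  have hL : 0 ≤ L := add_nonneg (he0 0) (by positivity)
  set R := 1 + c + M * L with hRdef
  have hML : 0 ≤ M * L := by positivity
  have hR1 : 1 ≤ R := by linarith
  have hR0 : 0 ≤ R := by linarith
  have main : ∀ n, a n ≤ K * R ^ n * n.factorial ∧ e n ≤ L * (n + 1) * R ^ n * n.factorial := by
    intro n
    induction n using Nat.strong_induction_on with
    | _ n ih =>
    -- `a n` comes first, since the inequality for `e n` involves `a n` as well.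
    have hA : a n ≤ K * R ^ n * n.factorial := by
      match n, ih with
      | 0, _ => simpa [hKdef] using ha0 1
      | 1, _ =>
        have : K ≤ K * R := le_mul_of_one_le_right hK hR1
        simp only [pow_one, Nat.factorial_one, Nat.cast_one, mul_one]
        linarith [ha0 0]
      | k + 2, ih =>
        have hs := sum_choose_le (k := k) hK hR0 he0 (fun j hj => (ih j (by omega)).1)
          (fun j hj => (ih j (by omega)).2)
        have h1 := (ih (k + 1) (by omega)).1
        refine (ha k).trans ?_
        refine (add_le_add (mul_le_mul_of_nonneg_left h1 hc)
          (mul_le_mul_of_nonneg_left hs hM)).trans ?_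
        have key : c * (k + 1) * R + M * L * ((k + 1) * (k + 2) / 2)
            ≤ R ^ 2 * ((k + 1) * (k + 2)) := by
          have hk : (0 : ℝ) ≤ k := Nat.cast_nonneg k
          have e1 : c * (k + 1) * R ≤ c * R * ((k + 1) * (k + 2)) := by
            calc c * (k + 1) * R = c * R * ((k + 1) * 1) := by ring
              _ ≤ c * R * ((k + 1) * (k + 2)) := by gcongr; linarith
          have e2 : M * L * ((k + 1) * (k + 2) / 2) ≤ M * L * R * ((k + 1) * (k + 2)) := by
            calc M * L * ((k + 1) * (k + 2) / 2) = M * L * (1 / 2) * ((k + 1) * (k + 2)) := by ring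
              _ ≤ M * L * R * ((k + 1) * (k + 2)) := by gcongr; linarith
          have e3 : c * R + M * L * R ≤ R ^ 2 := by
            rw [sq, ← add_mul]; exact mul_le_mul_of_nonneg_right (by linarith) hR0
          have := mul_le_mul_of_nonneg_right e3 (by positivity : (0 : ℝ) ≤ (k + 1) * (k + 2))
          linarith
        have := mul_le_mul_of_nonneg_left key (by positivity : 0 ≤ K * R ^ k * k.factorial)
        simp only [Nat.factorial_succ, Nat.cast_mul, Nat.cast_add, Nat.cast_one, pow_succ] at this ⊢
        linarith
    refine ⟨hA, ?_⟩
    match n, ih, hA with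
    | 0, _, _ =>
      have : 0 ≤ M * K ^ 2 := by positivity
      simp only [CharP.cast_eq_zero, zero_add, mul_one, pow_zero, Nat.factorial_zero, Nat.cast_one]
      linarith
    | k + 1, ih, hA =>
      have hA' : ∀ j ≤ k + 1, a j ≤ K * R ^ j * j.factorial := fun j hj => by
        rcases Nat.lt_or_ge j (k + 1) with h | h
        · exact (ih j h).1
        · rw [le_antisymm hj h]; exact hA
      have hs := sum_choose_le (k := k) (y := fun j => a (j + 1)) (L := K * R) hK hR0
        (fun j => ha0 _) (fun j hj => hA' j (by omega)) (fun j hj => by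
          refine (hA' (j + 1) (by omega)).trans_eq ?_
          simp only [Nat.factorial_succ, Nat.cast_mul, Nat.cast_add, Nat.cast_one, pow_succ]
          ring)
      refine (he k).trans ((mul_le_mul_of_nonneg_left hs hM).trans ?_)
      have hle : M * K ^ 2 ≤ L := by linarith [he0 0]
      have hpos : (0 : ℝ) ≤ R ^ (k + 1) * k.factorial * ((k + 1) * (k + 2)) := by positivity
      have h1 := mul_le_mul_of_nonneg_right hle hpos
      have h2 : 0 ≤ M * K ^ 2 * (R ^ (k + 1) * k.factorial * ((k + 1) * (k + 2))) := by positivity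
      simp only [Nat.factorial_succ, Nat.cast_mul, Nat.cast_add, Nat.cast_one, pow_succ] at h1 h2 ⊢
      linarith
  refine ⟨K + L, 2 * R, by linarith, fun n => ?_⟩
  have h2 : ((n : ℝ) + 1) ≤ 2 ^ n := by exact_mod_cast Nat.lt_two_pow_self (n := n)
  have h2' : (1 : ℝ) ≤ 2 ^ n := one_le_pow₀ (by norm_num)
  have hp : 0 ≤ R ^ n * n.factorial := by positivity
  rw [mul_pow]
  constructor
  · refine (main n).1.trans ?_
    calc K * R ^ n * n.factorial = K * 1 * (R ^ n * n.factorial) := by ring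
      _ ≤ (K + L) * 2 ^ n * (R ^ n * n.factorial) := by gcongr; linarith
      _ = _ := by ring
  · refine (main n).2.trans ?_
    calc L * (n + 1) * R ^ n * n.factorial = L * (n + 1) * (R ^ n * n.factorial) := by ring
      _ ≤ (K + L) * 2 ^ n * (R ^ n * n.factorial) := by gcongr; linarith
      _ = _ := by ring

/-! ### Holomorphic extension to a strip -/

theorem hasDerivAt_iteratedDeriv {f : ℝ → ℂ} (hf : ContDiff ℝ ∞ f) (k : ℕ) (x : ℝ) :
    HasDerivAt (iteratedDeriv k f) (iteratedDeriv (k + 1) f x) x := by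
  rw [iteratedDeriv_succ]
  exact ((hf.differentiable_iteratedDeriv k (by exact_mod_cast ENat.natCast_lt_top k)) x).hasDerivAt

theorem isPreconnected_strip (r : ℝ) : IsPreconnected (strip r) := by
  have : strip r = Complex.imCLM ⁻¹' (Ioo (-r) r) := by
    ext z; simp [strip, abs_lt]
  rw [this]
  exact ((convex_Ioo (-r) r).linear_preimage Complex.imLm).isPreconnected

theorem isOpen_strip (r : ℝ) : IsOpen (strip r) :=
  isOpen_lt (by fun_prop) continuous_const

/-- A smooth function with `|f^(k)| ≤ K R^k k!` on the whole line extends holomorphically to every strip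
of half-width less than `1 / R`, by `F (x + i y) = ∑ f^(k)(x) (i y)^k / k!`. -/
theorem exists_isAnalyticExtension {f : ℝ → ℂ} (hf : ContDiff ℝ ∞ f) {K R r : ℝ} (hR : 0 < R)
    (hb : ∀ k x, ‖iteratedDeriv k f x‖ ≤ K * R ^ k * k.factorial) (hr : 0 < r) (hrR : R * r < 1) :
    ∃ F : ℂ → ℂ, IsAnalyticExtension f r F := by
  -- The `k`-th term `t k` has real derivative `h ↦ p k * Re h + i q k * Im h`.
  set t : ℕ → ℂ → ℂ := fun k z =>
    iteratedDeriv k f z.re * ((Complex.I * z.im) ^ k / k.factorial) with ht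
  set p : ℕ → ℂ → ℂ := fun k z =>
    iteratedDeriv (k + 1) f z.re * ((Complex.I * z.im) ^ k / k.factorial) with hp
  set q : ℕ → ℂ → ℂ := fun k z =>
    iteratedDeriv k f z.re * (k * (Complex.I * z.im) ^ (k - 1) / k.factorial) with hq
  set D : ℕ → ℂ → ℂ →L[ℝ] ℂ := fun k z =>
    Complex.reCLM.smulRight (p k z) + Complex.imCLM.smulRight (Complex.I * q k z) with hD
  have hqp : ∀ k z, q (k + 1) z = p k z := by
    intro k z
    have : (k : ℂ) + 1 ≠ 0 := Nat.cast_add_one_ne_zero k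
    have : (k.factorial : ℂ) ≠ 0 := by exact_mod_cast k.factorial_ne_zero
    simp only [hq, hp, Nat.add_sub_cancel, Nat.factorial_succ]
    push_cast
    field_simp
  have hq0 : ∀ z, q 0 z = 0 := fun z => by simp [hq]
  have hderiv : ∀ k z, HasFDerivAt (t k) (D k z) z := by
    intro k z
    have h1 : HasFDerivAt (fun z : ℂ => iteratedDeriv k f z.re) _ z :=
      (hasDerivAt_iteratedDeriv hf k z.re).hasFDerivAt.comp z Complex.reCLM.hasFDerivAt
    have h2 : HasDerivAt (fun y : ℝ => (Complex.I * y) ^ k / (k.factorial : ℂ))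
        (k * (Complex.I * z.im) ^ (k - 1) * Complex.I / k.factorial) z.im := by
      have := (((Complex.ofRealCLM.hasDerivAt (x := z.im)).const_mul Complex.I).pow k).div_const
        (k.factorial : ℂ)
      simpa using this
    have h3 : HasFDerivAt (fun z : ℂ => (Complex.I * z.im) ^ k / (k.factorial : ℂ)) _ z :=
      h2.hasFDerivAt.comp z Complex.imCLM.hasFDerivAt
    refine (h1.mul h3).congr_fderiv ?_
    ext h
    simp [hD, hp, hq]
    ring
  set bp : ℕ → ℝ := fun k => K * R * ((k + 1) * (R * r) ^ k) with hbp
  have hK : 0 ≤ K := by simpa using (norm_nonneg _).trans (hb 0 0)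
  have hp_le : ∀ k z, z ∈ strip r → ‖p k z‖ ≤ bp k := by
    intro k z hz
    have hy : |z.im| ≤ r := le_of_lt hz
    have hfac : (0 : ℝ) < k.factorial := by positivity
    have h1 := hb (k + 1) z.re
    rw [hp]
    simp only [norm_mul, norm_div, norm_pow, Complex.norm_I, one_mul, Complex.norm_real,
      Real.norm_eq_abs, Complex.norm_natCast]
    calc _ ≤ (K * R ^ (k + 1) * (k + 1).factorial) * (r ^ k / k.factorial) := by gcongr
      _ = bp k := by
        rw [hbp, Nat.factorial_succ]
        push_cast
        field_simp
        ring
  have hbps : Summable bp := by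
    have hn : ‖R * r‖ < 1 := by rwa [Real.norm_of_nonneg (by positivity)]
    have h1 := summable_pow_mul_geometric_of_norm_lt_one 1 hn
    have h0 := summable_geometric_of_norm_lt_one hn
    refine Summable.mul_left _ ((h1.add h0).congr fun k => ?_)
    ring
  set bq : ℕ → ℝ := fun k => k.casesOn 0 bp with hbq
  have hbqs : Summable bq := (summable_nat_add_iff 1).1 hbps
  have hq_le : ∀ k z, z ∈ strip r → ‖q k z‖ ≤ bq k := by
    intro k z hz
    cases k with
    | zero => rw [hq0]; simp [hbq]
    | succ k => rw [hqp]; exact hp_le k z hz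
  have hD_le : ∀ k z, z ∈ strip r → ‖D k z‖ ≤ bp k + bq k := by
    intro k z hz
    refine (norm_add_le _ _).trans (add_le_add ?_ ?_)
    · rw [ContinuousLinearMap.norm_smulRight_apply, Complex.reCLM_norm, one_mul]
      exact hp_le k z hz
    · rw [ContinuousLinearMap.norm_smulRight_apply, Complex.imCLM_norm, one_mul, norm_mul,
        Complex.norm_I, one_mul]
      exact hq_le k z hz
  have h0 : (0 : ℂ) ∈ strip r := by simpa [strip] using hr
  have hreal : ∀ x : ℝ, ∀ k, k ≠ 0 → t k x = 0 := fun x k hk => by simp [ht, hk]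
  have hsum0 : Summable fun k => t k 0 :=
    summable_of_ne_finset_zero (s := {0}) fun k hk => by
      simpa using hreal 0 k (by simpa using hk)
  refine ⟨fun z => ∑' k, t k z, ?_, fun x => ?_⟩
  · refine DifferentiableOn.analyticOnNhd (fun z hz => ?_) (isOpen_strip r)
    have hF := hasFDerivAt_tsum_of_isPreconnected (hbps.add hbqs) (isOpen_strip r)
      (isPreconnected_strip r) (fun k z _ => hderiv k z) hD_le h0 hsum0 hz
    have hps : Summable fun k => p k z := .of_norm_bounded hbps fun k => hp_le k z hz
    have hqs : Summable fun k => q k z := .of_norm_bounded hbqs fun k => hq_le k z hz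
    have hDs : Summable fun k => D k z := .of_norm_bounded (hbps.add hbqs) fun k => hD_le k z hz
    have hpq : ∑' k, q k z = ∑' k, p k z := by
      rw [hqs.tsum_eq_zero_add, hq0, zero_add]
      simp only [hqp]
    -- Cauchy-Riemann: as `q (k + 1) = p k` and `q 0 = 0`, both partial derivatives have the same sum,
    -- and the real derivative is multiplication by that sum.
    have hC : (ContinuousLinearMap.restrictScalars ℝ
        (ContinuousLinearMap.toSpanSingleton ℂ (∑' k, p k z))) = ∑' k, D k z := by
      ext h
      have happ : (∑' k, D k z) h = ∑' k, D k z h := (ContinuousLinearMap.apply ℝ ℂ h).map_tsum hDs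
      rw [happ]
      simp only [hD, _root_.add_apply, ContinuousLinearMap.smulRight_apply]
      rw [Summable.tsum_add (hps.const_smul _) ((hqs.mul_left _).const_smul _), tsum_const_smul'',
        tsum_const_smul'', tsum_mul_left, hpq]
      simp only [ContinuousLinearMap.coe_restrictScalars',
        ContinuousLinearMap.toSpanSingleton_apply, Complex.reCLM_apply, Complex.imCLM_apply,
        Complex.real_smul, smul_eq_mul]
      conv_lhs => rw [← Complex.re_add_im h]
      ring
    exact (hasFDerivAt_of_restrictScalars ℝ hF hC).differentiableAt.differentiableWithinAt
  · change ∑' k, t k x = f x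
    rw [tsum_eq_single 0 (hreal x)]
    simp [ht]

/-! ### Estimates in `H¹(ℝ)` -/

theorem l2Norm_add_le {f g : ℝ → ℂ} (hf : MemLp f 2 volume) (hg : MemLp g 2 volume) :
    l2Norm (fun x => f x + g x) ≤ l2Norm f + l2Norm g := by
  rw [l2Norm, l2Norm, l2Norm, ← ENNReal.toReal_add hf.2.ne hg.2.ne]
  exact ENNReal.toReal_mono (by simp [hf.2.ne, hg.2.ne])
    (eLpNorm_add_le hf.1 hg.1 (by norm_num))

theorem l2Norm_const_mul (b : ℂ) (f : ℝ → ℂ) : l2Norm (fun x => b * f x) = ‖b‖ * l2Norm f := by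
  have : (fun x => b * f x) = b • f := rfl
  rw [this, l2Norm, eLpNorm_const_smul, ENNReal.toReal_mul, toReal_enorm, l2Norm]

theorem l2Norm_star (f : ℝ → ℂ) : l2Norm (fun x => star (f x)) = l2Norm f := by
  rw [l2Norm, l2Norm, eLpNorm_congr_norm_ae (Eventually.of_forall fun x => norm_star (f x))]

theorem l2Norm_mul_le {f g : ℝ → ℂ} {a : ℝ} (ha0 : 0 ≤ a) (ha : ∀ x, ‖f x‖ ≤ a)
    (hg : MemLp g 2 volume) : l2Norm (fun x => f x * g x) ≤ a * l2Norm g := by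
  have h := eLpNorm_le_mul_eLpNorm_of_ae_le_mul (f := fun x => f x * g x) (g := g) (c := a)
    (μ := volume) (Eventually.of_forall fun x => by
      rw [norm_mul]; exact mul_le_mul_of_nonneg_right (ha x) (norm_nonneg _)) 2
  have := ENNReal.toReal_mono (ENNReal.mul_ne_top ENNReal.ofReal_ne_top hg.2.ne) h
  rwa [ENNReal.toReal_mul, ENNReal.toReal_ofReal ha0] at this

/-- The norm `‖f‖ + ‖f'‖` of `H¹(ℝ)`. -/
noncomputable def h1Norm (f : ℝ → ℂ) : ℝ := l2Norm f + l2Norm (deriv f)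

theorem h1Norm_nonneg (f : ℝ → ℂ) : 0 ≤ h1Norm f :=
  add_nonneg (l2Norm_nonneg _) (l2Norm_nonneg _)

theorem h1Norm_add_le {f g : ℝ → ℂ} (hf : SquareIntegrableUpTo 1 f)
    (hg : SquareIntegrableUpTo 1 g) : h1Norm (fun x => f x + g x) ≤ h1Norm f + h1Norm g := by
  have h : deriv (fun x => f x + g x) = fun x => deriv f x + deriv g x :=
    funext fun x => ((hf.1 x).hasDerivAt.add (hg.1 x).hasDerivAt).deriv
  have h1 := l2Norm_add_le hf.2.1 hg.2.1
  have h2 := l2Norm_add_le hf.2.2.2 hg.2.2.2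
  rw [h1Norm, h, h1Norm, h1Norm]
  linarith

theorem h1Norm_const_mul (b : ℂ) (f : ℝ → ℂ) :
    h1Norm (fun x => b * f x) = ‖b‖ * h1Norm f := by
  have h : deriv (fun x => b * f x) = fun x => b * deriv f x :=
    funext fun x => deriv_const_mul_field b
  rw [h1Norm, h, l2Norm_const_mul, l2Norm_const_mul, h1Norm]
  ring

theorem h1Norm_sum_le {ι : Type*} (s : Finset ι) {F : ι → ℝ → ℂ}
    (hF : ∀ i, SquareIntegrableUpTo 1 (F i)) :
    SquareIntegrableUpTo 1 (fun x => ∑ i ∈ s, F i x) ∧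
      h1Norm (fun x => ∑ i ∈ s, F i x) ≤ ∑ i ∈ s, h1Norm (F i) := by
  classical
  induction s using Finset.induction_on with
  | empty =>
    have h : deriv (fun _ : ℝ => (0 : ℂ)) = fun _ => 0 := funext fun x => deriv_const x 0
    have h0 : l2Norm (fun _ => 0) = 0 := by simp [l2Norm]
    simp only [Finset.sum_empty]
    refine ⟨⟨differentiable_const 0, MemLp.zero', ?_⟩, ?_⟩
    · rw [h]; exact ⟨continuous_const, MemLp.zero'⟩
    · rw [h1Norm, h, h0, add_zero]
  | insert i s his ih =>
    simp only [Finset.sum_insert his]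
    exact ⟨(hF i).add ih.1, (h1Norm_add_le (hF i) ih.1).trans (add_le_add_right ih.2 _)⟩

/-- Bounds on the derivatives of a bounded function with derivatives in `L²`: `a k` dominates the
sup norm of the `k`-th derivative and the `L²` norm of the next one. -/
structure HasDerivBounds (f : ℝ → ℂ) (a : ℕ → ℝ) : Prop where
  contDiff : ContDiff ℝ ∞ f
  norm_le : ∀ k x, ‖iteratedDeriv k f x‖ ≤ a k
  memLp : ∀ k, MemLp (iteratedDeriv (k + 1) f) 2 volume
  l2Norm_le : ∀ k, l2Norm (iteratedDeriv (k + 1) f) ≤ a k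

theorem iteratedDeriv_star_comp (f : ℝ → ℂ) (k : ℕ) :
    iteratedDeriv k (fun x => star (f x)) = fun x => star (iteratedDeriv k f x) := by
  induction k with
  | zero => simp
  | succ k ih =>
    rw [iteratedDeriv_succ, ih]
    funext x
    rw [iteratedDeriv_succ]
    exact deriv.star

theorem HasDerivBounds.star {f : ℝ → ℂ} {a : ℕ → ℝ} (h : HasDerivBounds f a) :
    HasDerivBounds (fun x => star (f x)) a where
  contDiff := (starL' ℝ : ℂ ≃L[ℝ] ℂ).contDiff.comp h.contDiff
  norm_le k x := by rw [iteratedDeriv_star_comp, norm_star]; exact h.norm_le k x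
  memLp k := by rw [iteratedDeriv_star_comp]; exact (h.memLp k).star
  l2Norm_le k := by rw [iteratedDeriv_star_comp, l2Norm_star]; exact h.l2Norm_le k

theorem SquareIntegrableUpTo.iteratedDeriv {f : ℝ → ℂ} (h : ∀ n, SquareIntegrableUpTo n f) (k : ℕ) :
    ∀ n, SquareIntegrableUpTo n (iteratedDeriv k f) := by
  induction k with
  | zero => simpa using h
  | succ k ih =>
    intro n
    rw [iteratedDeriv_succ]
    exact (ih (n + 1)).2.2

theorem SquareIntegrableUpTo.contDiff {f : ℝ → ℂ} (h : ∀ n, SquareIntegrableUpTo n f) :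
    ContDiff ℝ ∞ f :=
  contDiff_of_differentiable_iteratedDeriv fun m _ => (SquareIntegrableUpTo.iteratedDeriv h m 1).1

/-- The product estimate in `H¹(ℝ)`. The factor `f` need not be in `L²`: this makes it apply to `u`. -/
theorem h1Norm_mul_le {f g : ℝ → ℂ} {a : ℝ} (hf : Differentiable ℝ f) (ha : ∀ x, ‖f x‖ ≤ a)
    (hL : MemLp (deriv f) 2 volume) (hd : l2Norm (deriv f) ≤ a) (hg : SquareIntegrableUpTo 1 g) :
    h1Norm (fun x => f x * g x) ≤ 2 * a * h1Norm g := by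
  have ha0 : 0 ≤ a := (norm_nonneg _).trans (ha 0)
  have h : deriv (fun x => f x * g x) = fun x => g x * deriv f x + f x * deriv g x :=
    funext fun x => by
      rw [mul_comm (g x)]
      exact ((hf x).hasDerivAt.mul (hg.1 x).hasDerivAt).deriv
  have m1 : MemLp (fun x => g x * deriv f x) 2 volume :=
    memLp_bounded_mul hg.1.continuous ⟨_, hg.norm_le⟩ hL
  have m2 : MemLp (fun x => f x * deriv g x) 2 volume :=
    memLp_bounded_mul hf.continuous ⟨a, ha⟩ hg.2.2.2
  have e1 := l2Norm_mul_le ha0 ha hg.2.1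
  have e2 := l2Norm_mul_le ha0 ha hg.2.2.2
  have e3 := l2Norm_mul_le (h1Norm_nonneg g) hg.norm_le hL
  have e4 := l2Norm_add_le m1 m2
  have e5 : h1Norm g * l2Norm (deriv f) ≤ h1Norm g * a :=
    mul_le_mul_of_nonneg_left hd (h1Norm_nonneg g)
  have e6 : h1Norm g = l2Norm g + l2Norm (deriv g) := rfl
  rw [h1Norm, h]
  calc _ ≤ a * l2Norm g + (h1Norm g * a + a * l2Norm (deriv g)) := by linarith
    _ = 2 * a * h1Norm g := by rw [e6]; ring

/-! ### Bounds on all derivatives of a solution -/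

theorem HasDerivBounds.boundedUpTo {f : ℝ → ℂ} {a : ℕ → ℝ} (h : HasDerivBounds f a) (n k : ℕ) :
    BoundedUpTo n (iteratedDeriv k f) := by
  have hd : ∀ k, Differentiable ℝ (iteratedDeriv k f) := fun k x =>
    (hasDerivAt_iteratedDeriv h.contDiff k x).differentiableAt
  induction n generalizing k with
  | zero => exact ⟨(hd k).continuous, a k, h.norm_le k⟩
  | succ n ih => exact ⟨hd k, ⟨a k, h.norm_le k⟩, iteratedDeriv_succ (f := f) ▸ ih (k + 1)⟩

/-- The Leibniz rule, in the form of an estimate in the Banach algebra `H¹(ℝ)`. -/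
theorem HasDerivBounds.h1Norm_iteratedDeriv_mul_le {f g : ℝ → ℂ} {a : ℕ → ℝ}
    (hf : HasDerivBounds f a) (hg : ∀ n, SquareIntegrableUpTo n g) (k : ℕ) :
    h1Norm (iteratedDeriv k (fun x => f x * g x)) ≤ 2 * ∑ j ∈ Finset.range (k + 1),
      (k.choose j : ℝ) * (a j * h1Norm (iteratedDeriv (k - j) g)) := by
  have hgk := SquareIntegrableUpTo.iteratedDeriv hg
  have h1 : iteratedDeriv k (fun x => f x * g x) = fun x => ∑ j ∈ Finset.range (k + 1),
      (k.choose j : ℂ) * (iteratedDeriv j f x * iteratedDeriv (k - j) g x) := by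
    funext x
    have hle : ((k : ℕ∞) : WithTop ℕ∞) ≤ ((⊤ : ℕ∞) : WithTop ℕ∞) := by exact_mod_cast le_top
    rw [iteratedDeriv_fun_mul (hf.contDiff.of_le hle).contDiffAt
      ((SquareIntegrableUpTo.contDiff hg).of_le hle).contDiffAt]
    simp only [mul_assoc]
  have hs : ∀ j, SquareIntegrableUpTo 1
      (fun x => iteratedDeriv j f x * iteratedDeriv (k - j) g x) := fun j =>
    SquareIntegrableUpTo.bounded_mul (hf.boundedUpTo 1 j) (hgk (k - j) 1)
  rw [h1, Finset.mul_sum]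
  refine (h1Norm_sum_le _ fun j => (hs j).const_mul _).2.trans (Finset.sum_le_sum fun j _ => ?_)
  rw [h1Norm_const_mul, Complex.norm_natCast]
  have hd : deriv (iteratedDeriv j f) = iteratedDeriv (j + 1) f := iteratedDeriv_succ.symm
  have := h1Norm_mul_le (a := a j)
    (fun x => (hasDerivAt_iteratedDeriv hf.contDiff j x).differentiableAt)
    (hf.norm_le j) (hd ▸ hf.memLp j) (hd ▸ hf.l2Norm_le j) (hgk (k - j) 1)
  calc _ ≤ (k.choose j : ℝ) * (2 * a j * h1Norm (iteratedDeriv (k - j) g)) := by gcongr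
    _ = _ := by ring

/-- The representatives of `𝒲 * f` of the various orders of regularity coincide, being continuous. -/
theorem exists_conv_ae_eq_smooth (W : Potential) {f : ℝ → ℂ} (hf : ∀ n, SquareIntegrableUpTo n f)
    (hL : MemLp f 2 volume) :
    ∃ θ : ℝ → ℂ, (∀ n, SquareIntegrableUpTo n θ) ∧ W.conv (hL.toLp f) =ᵐ[volume] θ := by
  obtain ⟨θ, hθ, he⟩ := (hf 1).exists_conv_ae_eq W hL
  refine ⟨θ, fun n => ?_, he⟩
  obtain ⟨χ, hχ, he'⟩ := (hf (n + 1)).exists_conv_ae_eq W hL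
  rwa [(hθ.continuous.ae_eq_iff_eq volume hχ.continuous).1 (he.symm.trans he')]

theorem conv_iteratedDeriv_ae_eq (W : Potential) {f θ : ℝ → ℂ}
    (hf : ∀ n, SquareIntegrableUpTo n f) (hθ : ∀ n, SquareIntegrableUpTo n θ)
    (hL : ∀ k, MemLp (iteratedDeriv k f) 2 volume)
    (he : W.conv ((hL 0).toLp (iteratedDeriv 0 f)) =ᵐ[volume] θ) (k : ℕ) :
    W.conv ((hL k).toLp (iteratedDeriv k f)) =ᵐ[volume] iteratedDeriv k θ := by
  have hfc := SquareIntegrableUpTo.contDiff hf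
  have hθc := SquareIntegrableUpTo.contDiff hθ
  induction k with
  | zero => simpa using he
  | succ k ih =>
    obtain ⟨χ, hχ, hχe⟩ := (SquareIntegrableUpTo.iteratedDeriv hf (k + 1) 1).exists_conv_ae_eq W
      (hL (k + 1))
    have hw := (hasWeakDeriv_conv W (hasDerivAt_iteratedDeriv hfc k) (hL k) (hL (k + 1))).congr
      ih hχe
    have hd := hw.hasDerivAt_of_continuous
      (SquareIntegrableUpTo.iteratedDeriv hθ k 0).continuous hχ.continuous
    have : iteratedDeriv (k + 1) θ = χ :=
      funext fun x => (hasDerivAt_iteratedDeriv hθc k x).unique (hd x)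
    rwa [this]

theorem exists_h1Norm_conv_le (W : Potential) : ∃ M : ℝ, 0 ≤ M ∧ ∀ f θ : ℝ → ℂ,
    ∀ hf : ∀ n, SquareIntegrableUpTo n f, (∀ n, SquareIntegrableUpTo n θ) →
    W.conv ((hf 0).memLp.toLp f) =ᵐ[volume] θ →
    ∀ k, h1Norm (iteratedDeriv k θ) ≤ M * h1Norm (iteratedDeriv k f) := by
  refine ⟨‖W.memLp_symbol.toLp _‖, norm_nonneg _, fun f θ hf hθ he k => ?_⟩
  have hL : ∀ k, MemLp (iteratedDeriv k f) 2 volume := fun k =>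
    (SquareIntegrableUpTo.iteratedDeriv hf k 0).memLp
  have hk := conv_iteratedDeriv_ae_eq W hf hθ hL (by simpa using he)
  have hb : ∀ k, l2Norm (iteratedDeriv k θ)
      ≤ ‖W.memLp_symbol.toLp _‖ * l2Norm (iteratedDeriv k f) := by
    intro k
    have := conv_norm_le W ((hL k).toLp _)
    rwa [Lp.norm_toLp (iteratedDeriv k f), Lp.norm_def (W.conv _), eLpNorm_congr_ae (hk k)] at this
  rw [h1Norm, h1Norm, ← iteratedDeriv_succ, ← iteratedDeriv_succ, mul_add]
  exact add_le_add (hb k) (hb (k + 1))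

/-- Factorial bounds for all derivatives of a solution and of `η`. -/
theorem exists_factorial_bound_of_solution (W : Potential) {c : ℝ} {u v : ℝ → ℂ}
    (hu : ∀ x, HasDerivAt u (v x) x) (hub : ∃ C, ∀ x, ‖u x‖ ≤ C)
    (hvn : ∀ n, SquareIntegrableUpTo n v) (hηn : ∀ n, SquareIntegrableUpTo n (eta u))
    (hw : HasWeakDeriv v (fun x =>
      -(Complex.I * c) * v x + -1 * (u x * W.conv ((hηn 0).memLp.toLp (eta u)) x))) :
    ContDiff ℝ ∞ u ∧ ∃ K R : ℝ, 0 < R ∧ ∀ k x,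
      ‖iteratedDeriv k u x‖ ≤ K * R ^ k * k.factorial ∧
      ‖iteratedDeriv k (eta u) x‖ ≤ K * R ^ k * k.factorial := by
  obtain ⟨C, hC⟩ := hub
  have hdu : deriv u = v := funext fun x => (hu x).deriv
  have huc : ContDiff ℝ ∞ u := contDiff_infty_iff_deriv.2
    ⟨fun x => (hu x).differentiableAt, hdu ▸ SquareIntegrableUpTo.contDiff hvn⟩
  have hsucc : ∀ k, iteratedDeriv (k + 1) u = iteratedDeriv k v := fun k => by
    rw [iteratedDeriv_succ', hdu]
  have hvk := SquareIntegrableUpTo.iteratedDeriv hvn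
  -- `u` itself is not in `L²`: at order zero the sup norm replaces the `H¹` norm.
  set a : ℕ → ℝ := fun k => k.casesOn (C + l2Norm v) fun k => h1Norm (iteratedDeriv k v) with ha
  have ha_succ : ∀ k, a (k + 1) = h1Norm (iteratedDeriv k v) := fun k => rfl
  have hl2 : ∀ k, l2Norm (iteratedDeriv k v) ≤ a k := by
    intro k
    cases k with
    | zero =>
      have : 0 ≤ C := (norm_nonneg _).trans (hC 0)
      simpa [ha] using this
    | succ k =>
      rw [ha_succ, h1Norm, iteratedDeriv_succ]
      exact le_add_of_nonneg_left (l2Norm_nonneg _)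
  have hB : HasDerivBounds u a := by
    refine ⟨huc, fun k x => ?_, fun k => ?_, fun k => ?_⟩
    · cases k with
      | zero =>
        have := l2Norm_nonneg v
        change ‖iteratedDeriv 0 u x‖ ≤ C + l2Norm v
        rw [iteratedDeriv_zero]
        linarith [hC x]
      | succ k => rw [hsucc, ha_succ]; exact (hvk k 1).norm_le x
    · rw [hsucc]; exact (hvk k 0).memLp
    · rw [hsucc]; exact hl2 k
  obtain ⟨M, hM, hMb⟩ := exists_h1Norm_conv_le W
  obtain ⟨θ, hθ, hθe⟩ := exists_conv_ae_eq_smooth W hηn (hηn 0).memLp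
  have hMθ := hMb (eta u) θ hηn hθ hθe
  have huθ : ∀ n, SquareIntegrableUpTo n (fun x => u x * θ x) := fun n =>
    SquareIntegrableUpTo.bounded_mul (by simpa using hB.boundedUpTo n 0) (hθ n)
  have hdv : deriv v = fun x => -(Complex.I * c) * v x + -1 * (u x * θ x) := by
    have hr : Continuous fun x => -(Complex.I * c) * v x + -1 * (u x * θ x) :=
      ((hvn 0).continuous.const_mul _).add ((huθ 0).continuous.const_mul _)
    refine funext fun x => HasDerivAt.deriv (HasWeakDeriv.hasDerivAt_of_continuous
      (hw.congr (ae_eq_refl _) ?_) (hvn 0).continuous hr x)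
    filter_upwards [hθe] with x hx
    rw [hx]
  have hdη : deriv (eta u) = fun x => -1 * (star (u x) * v x) + -1 * (u x * star (v x)) := by
    funext x
    rw [(hasDerivAt_eta (hu x)).deriv]
    ring
  have hlin : ∀ {f g : ℝ → ℂ} (b d : ℂ) (k : ℕ), (∀ n, SquareIntegrableUpTo n f) →
      (∀ n, SquareIntegrableUpTo n g) → h1Norm (iteratedDeriv k (fun x => b * f x + d * g x))
        ≤ ‖b‖ * h1Norm (iteratedDeriv k f) + ‖d‖ * h1Norm (iteratedDeriv k g) := by
    intro f g b d k hf hg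
    have h1 : iteratedDeriv k (fun x => b * f x + d * g x)
        = fun x => b * iteratedDeriv k f x + d * iteratedDeriv k g x := by
      funext x
      have hle : ((k : ℕ∞) : WithTop ℕ∞) ≤ ((⊤ : ℕ∞) : WithTop ℕ∞) := by exact_mod_cast le_top
      rw [iteratedDeriv_fun_add
        ((SquareIntegrableUpTo.contDiff fun n => (hf n).const_mul b).of_le hle).contDiffAt
        ((SquareIntegrableUpTo.contDiff fun n => (hg n).const_mul d).of_le hle).contDiffAt,
        iteratedDeriv_const_mul_field, iteratedDeriv_const_mul_field]
    rw [h1, ← h1Norm_const_mul, ← h1Norm_const_mul]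
    exact h1Norm_add_le ((SquareIntegrableUpTo.iteratedDeriv hf k 1).const_mul b)
      ((SquareIntegrableUpTo.iteratedDeriv hg k 1).const_mul d)
  have ha0 : ∀ k, 0 ≤ a k := fun k => (l2Norm_nonneg _).trans (hl2 k)
  suffices h : ∃ K R : ℝ, 0 < R ∧ ∀ k, a k ≤ K * R ^ k * k.factorial ∧
      h1Norm (iteratedDeriv k (eta u)) ≤ K * R ^ k * k.factorial by
    obtain ⟨K, R, hR, hb⟩ := h
    refine ⟨huc, K, R, hR, fun k x => ⟨(hB.norm_le k x).trans (hb k).1, ?_⟩⟩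
    exact ((SquareIntegrableUpTo.iteratedDeriv hηn k 1).norm_le x).trans (hb k).2
  refine exists_factorial_bound (c := |c|) (M := 2 * M + 4)
    (abs_nonneg c) (by linarith) ha0 (fun k => h1Norm_nonneg _) (fun k => ?_) (fun k => ?_)
  · rw [ha_succ, ha_succ, iteratedDeriv_succ', hdv]
    refine (hlin _ _ k hvn huθ).trans ?_
    have h1 := hB.h1Norm_iteratedDeriv_mul_le hθ k
    have h2 : ∑ j ∈ Finset.range (k + 1), (k.choose j : ℝ) * (a j * h1Norm (iteratedDeriv (k - j) θ))
        ≤ M * ∑ j ∈ Finset.range (k + 1),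
          (k.choose j : ℝ) * (a j * h1Norm (iteratedDeriv (k - j) (eta u))) := by
      rw [Finset.mul_sum]
      refine Finset.sum_le_sum fun j _ => ?_
      calc _ ≤ (k.choose j : ℝ) * (a j * (M * h1Norm (iteratedDeriv (k - j) (eta u)))) := by
            have := ha0 j
            have := hMθ (k - j)
            gcongr
        _ = _ := by ring
    have h3 : 0 ≤ ∑ j ∈ Finset.range (k + 1),
          (k.choose j : ℝ) * (a j * h1Norm (iteratedDeriv (k - j) (eta u))) :=
      Finset.sum_nonneg fun j _ => mul_nonneg (by positivity) (mul_nonneg (ha0 j) (h1Norm_nonneg _))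
    simp only [norm_neg, norm_mul, Complex.norm_I, one_mul, Complex.norm_real, Real.norm_eq_abs,
      norm_one]
    linarith
  · have hvs : ∀ n, SquareIntegrableUpTo n (fun x => star (v x)) := fun n => (hvn n).star
    have hb1 : ∀ n, SquareIntegrableUpTo n (fun x => star (u x) * v x) := fun n =>
      SquareIntegrableUpTo.bounded_mul (by simpa using hB.star.boundedUpTo n 0) (hvn n)
    have hb2 : ∀ n, SquareIntegrableUpTo n (fun x => u x * star (v x)) := fun n =>
      SquareIntegrableUpTo.bounded_mul (by simpa using hB.boundedUpTo n 0) (hvs n)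
    have hns : ∀ f : ℝ → ℂ, h1Norm (fun x => star (f x)) = h1Norm f := fun f => by
      rw [h1Norm, deriv.star', l2Norm_star, l2Norm_star, h1Norm]
    rw [iteratedDeriv_succ', hdη]
    refine (hlin _ _ k hb1 hb2).trans ?_
    have h1 := hB.star.h1Norm_iteratedDeriv_mul_le hvn k
    have h2 := hB.h1Norm_iteratedDeriv_mul_le hvs k
    simp only [iteratedDeriv_star_comp, hns] at h2
    have h3 : 0 ≤ ∑ j ∈ Finset.range (k + 1),
          (k.choose j : ℝ) * (a j * h1Norm (iteratedDeriv (k - j) v)) :=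
      Finset.sum_nonneg fun j _ => mul_nonneg (by positivity) (mul_nonneg (ha0 j) (h1Norm_nonneg _))
    simp only [ha_succ, norm_neg, norm_one, one_mul]
    have h4 := mul_nonneg hM h3
    linarith

end NonlocalGP

theorem theorem5p9 (W : NonlocalGP.Potential) (σ κ C : ℝ)
    (hσ : σ ∈ Set.Ioc (0 : ℝ) 1) (hκ : κ ∈ Set.Icc (0 : ℝ) (1 / 2)) (hC : 0 < C)
    (hlower : ∀ᵐ ξ : ℝ, σ - κ * ξ ^ 2 ≤ W.hat ξ)
    (hderiv : ∃ dW : ℝ → ℝ, NonlocalGP.HasWeakDeriv W.hat dW ∧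
      ∀ᵐ ξ : ℝ, |dW ξ| ≤ C * (|ξ| + 1))
    (c : ℝ) (hc : c ∈ Set.Ico (0 : ℝ) (Real.sqrt (2 * σ)))
    (u : ℝ → ℂ) (hu : NonlocalGP.IsFiniteEnergySolution W c u) :
    ∃ v : ℝ → ℂ, Continuous v ∧ u =ᵐ[volume] v ∧
      (∃ r : ℝ, 0 < r ∧
        (∃ H : ℂ → ℂ, NonlocalGP.IsAnalyticExtension (NonlocalGP.eta v) r H) ∧
        (∃ U : ℂ → ℂ, NonlocalGP.IsAnalyticExtension v r U)) ∧
      (0 < c →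
        AnalyticOnNhd ℝ (fun x : ℝ => (v x).re) Set.univ ∧
        AnalyticOnNhd ℝ (fun x : ℝ => (v x).im) Set.univ) := by
  obtain ⟨U, V, hη, huU, hU, hUb, hVc, hVL, hw⟩ := hu.exists_representative
  have hreg := NonlocalGP.squareIntegrableUpTo_deriv_of_solution W hU hUb hVc hVL hη hw
  have hηn : ∀ n, NonlocalGP.SquareIntegrableUpTo n (NonlocalGP.eta U) := fun n =>
    (hreg n).2.2.of_succ
  obtain ⟨hUc, K, R, hR, hb⟩ := NonlocalGP.exists_factorial_bound_of_solution W hU hUb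
    (fun n => (hreg n).1) hηn hw
  have hr : 0 < 1 / (2 * R) := by positivity
  have hrR : R * (1 / (2 * R)) < 1 := by
    rw [mul_one_div, div_lt_one (by positivity)]
    linarith
  obtain ⟨F, hF⟩ := NonlocalGP.exists_isAnalyticExtension hUc hR (fun k x => (hb k x).1) hr hrR
  obtain ⟨H, hH⟩ := NonlocalGP.exists_isAnalyticExtension
    (NonlocalGP.SquareIntegrableUpTo.contDiff hηn) hR (fun k x => (hb k x).2) hr hrR
  have hFx : ∀ x : ℝ, AnalyticAt ℂ F x := fun x => hF.1 x (by simpa [NonlocalGP.strip] using hr)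
  refine ⟨U, hUc.continuous, huU, ⟨_, hr, ⟨H, hH⟩, ⟨F, hF⟩⟩, fun _ => ⟨fun x _ => ?_, fun x _ => ?_⟩⟩
  · simpa only [hF.2] using (hFx x).re_ofReal
  · simpa only [hF.2] using (hFx x).im_ofReal
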